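/- Let $d\ge 1$, $b<0$, $G(u)=u_1-b$ for $u\in\mathbb R^d$, and $\widetilde G=\max\{0,G\}$. Let $U_0^{(1)},U_0^{(2)},\dots$ be independent standard Gaussian random vectors in $\mathbb R^d$. For an ensemble $\mathbf u=(u^{(1)},\dots,u^{(J)})$ write $\overline u=\frac1J\sum_k u^{(k)}$, $\overline{\widetilde G}=\frac1J\sum_k\widetilde G(u^{(k)})$, $$C_{\mathrm{up}}(\mathbf u)=\frac1J\sum_{k=1}^J\bigl(\widetilde G(u^{(k)})-\overline{\widetilde G}\bigr)\bigl(u^{(k)}-\overline u\bigr),\qquad C_{\mathrm{pp}}(\mathbf u)=\frac1J\sum_{k=1}^J\bigl(\widetilde G(u^{(k)})-\overline{\widetilde G}\bigr)^2 .$$ The noise-free ensemble Kalman filter (EnKF) with step size $h>0$ (data $0$, unit observational variance) is the iteration $$u_{n+1}^{(j)}=u_n^{(j)}-C_{\mathrm{up}}(\mathbf u_n)\Bigl(C_{\mathrm{pp}}(\mathbf u_n)+\tfrac1h\Bigr)^{-1}\widetilde G(u_n^{(j)}),\qquad u_0^{(j)}=U_0^{(j)},\quad j=1,\dots,J.$$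 For every $J$ and $t\ge 0$ the iterates after $\lfloor t/h\rfloor$ steps converge as $h\to0$ to an ensemble $\mathbf u_J(t)=(u_J^{(j)}(t))_{j\le J}$, which starts at $(U_0^{(j)})_{j\le J}$ and solves for $t\ge0$ $$\frac{\mathrm d u^{(j)}}{\mathrm dt}=\frac1J\sum_{k=1}^J\bigl(\widetilde G(u^{(k)})-\overline{\widetilde G}\bigr)\bigl(-\widetilde G(u^{(j)})\bigr)\bigl(u^{(k)}-\overline u\bigr),\qquad j=1,\dots,J .$$ Almost surely, for all $t\ge0$, as $J\to\infty$ the empirical measures of $\mathbf u_J(t)$ converge weakly to a (deterministic) probability measure $\mu_t$ with finite mean $m(t)=\int x\,\mathrm d\mu_t(x)$, and the ensemble means $\frac1J\sum_{j=1}^J u_J^{(j)}(t)$ converge to $m(t)$. Moreover $$\lim_{t\to\infty}m(t)=(1-P_f)\,u^{\mathrm{MLFP}}+P_f\,u^{\mathrm{opt}} .$$ Here, for $U$ standard Gaussian in $\mathbb R^d$, $P_f=\mathbb P(G(U)<0)$, $u^{\mathrm{opt}}=\mathbb E[U\mid G(U)<0]=\mathbb E[U\mid U_1<b]$ is the mean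 of the optimal importance sampling density, and $u^{\mathrm{MLFP}}=(b,0,\dots,0)$ is the most likely failure point, i.e. the unique minimizer of $\frac12\|u\|_2^2$ subject to $G(u)=0$. -/

import Mathlib

open Filter Topology MeasureTheory ProbabilityTheory

noncomputable section

namespace EnKF

/-- The parameter space `ℝ^d` with its Euclidean norm. -/
abbrev Space (d : ℕ) : Type := EuclideanSpace ℝ (Fin d)

/-- The ensemble average `(1/J) ∑ₖ f k`. -/
def avg {E : Type*} [AddCommGroup E] [Module ℝ E] {J : ℕ} (f : Fin J → E) : E :=
  (J : ℝ)⁻¹ • ∑ k, f k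

/-- The auxiliary limit state function `G̃ = max {0, G}`. -/
def aux {d : ℕ} (G : Space d → ℝ) (u : Space d) : ℝ := max 0 (G u)

/-- Empirical cross-covariance of the particles and their images under the forward map `g`. -/
def covUP {d J : ℕ} (g : Space d → ℝ) (u : Fin J → Space d) : Space d :=
  avg fun k => (g (u k) - avg fun i => g (u i)) • (u k - avg u)

/-- Empirical variance of the images of the particles under the forward map `g`. -/
def covPP {d J : ℕ} (g : Space d → ℝ) (u : Fin J → Space d) : ℝ :=
  avg fun k => (g (u k) - avg fun i => g (u i)) ^ 2

/-- One noise-free EnKF update with step size `h`, forward map `G̃`, data `0` and unit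
observational variance. -/
def step {d J : ℕ} (G : Space d → ℝ) (h : ℝ) (u : Fin J → Space d) : Fin J → Space d :=
  fun j => u j + ((covPP (aux G) u + 1 / h)⁻¹ * (0 - aux G (u j))) • covUP (aux G) u

/-- The ensemble after `n` noise-free EnKF updates of step size `h`, started at `u₀`. -/
def iter {d J : ℕ} (G : Space d → ℝ) (h : ℝ) (u₀ : Fin J → Space d) (n : ℕ) :
    Fin J → Space d :=
  (step G h)^[n] u₀

/-- `u` is the continuous-time noise-free EnKF started at `u₀`: on `[0, ∞)` it solves
`du⁽ʲ⁾/dt = (1/J) ∑ₖ (G̃(u⁽ᵏ⁾) - mean of G̃) (-G̃(u⁽ʲ⁾)) (u⁽ᵏ⁾ - mean of u)`,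
and at each time `t ≥ 0` it is the limit, as the step size `h` tends to `0`, of the
EnKF iterates after `⌊t / h⌋` steps. -/
structure IsContinuousTimeLimit {d J : ℕ} (G : Space d → ℝ) (u₀ : Fin J → Space d)
    (u : ℝ → Fin J → Space d) : Prop where
  initial : u 0 = u₀
  flow : ∀ t : ℝ, 0 ≤ t → ∀ j : Fin J,
    HasDerivWithinAt (fun s => u s j)
      (avg fun k => ((aux G (u t k) - avg fun i => aux G (u t i)) * (-aux G (u t j))) •
        (u t k - avg (u t)))
      (Set.Ici 0) t
  limit : ∀ t : ℝ, 0 ≤ t →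
    Tendsto (fun h : ℝ => iter G h u₀ ⌊t / h⌋₊) (𝓝[>] 0) (𝓝 (u t))

/-- `μ` is the large-ensemble limit of a family of ensembles `v J` of sizes `J = 0, 1, 2, …`: it is
the weak limit of their empirical measures, it has a mean, and the ensemble means converge to
that mean. -/
structure IsLargeEnsembleLimit {d : ℕ} (v : (J : ℕ) → Fin J → Space d)
    (μ : ProbabilityMeasure (Space d)) : Prop where
  weak : ∀ f : BoundedContinuousFunction (Space d) ℝ,
    Tendsto (fun J => avg fun j => f (v J j)) atTop (𝓝 (∫ x, f x ∂(μ : Measure (Space d))))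
  integrable : Integrable (fun x : Space d => x) (μ : Measure (Space d))
  mean : Tendsto (fun J => avg (v J)) atTop (𝓝 (∫ x, x ∂(μ : Measure (Space d))))

/-- The affine limit state function `G(u) = u₁ - b`. -/
def affineLSF (d : ℕ) [NeZero d] (b : ℝ) (u : Space d) : ℝ := u 0 - b

/-- The probability of failure `P_f = ℙ(G(U) < 0)` for a standard Gaussian `U`. -/
def failureProb {d : ℕ} (G : Space d → ℝ) : ℝ := (stdGaussian (Space d)).real {u | G u < 0}

/-- The mean `𝔼[U ∣ G(U) < 0]`, for a standard Gaussian `U`, of the optimal importance sampling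
density. -/
def optMean {d : ℕ} (G : Space d → ℝ) : Space d :=
  ∫ u, u ∂(cond (stdGaussian (Space d)) {u | G u < 0})

/-- `u` is a most likely failure point: it minimizes `‖u‖² / 2` subject to `G(u) = 0`. -/
def IsMLFP {d : ℕ} (G : Space d → ℝ) (u : Space d) : Prop :=
  G u = 0 ∧ ∀ v : Space d, G v = 0 → 1 / 2 * ‖u‖ ^ 2 ≤ 1 / 2 * ‖v‖ ^ 2

end EnKF

end

/-! The particle system reduces to one scalar equation. Displace each particle by `-(1 - ρ) G̃(U⁽ʲ⁾)
e`, with `e 0 = 1`, `ρ ≥ 0`, and `e` parallel to the initial cross-covariance. Then `G̃` is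
multiplied by `ρ` on every particle, and bilinearity gives cross-covariance `ρ (A ρ + B) e` and
variance `ρ² A`, where `A` is the initial variance of `G̃` and `A + B` its covariance with the first
coordinate. So the family is invariant: an EnKF step changes only `ρ`, by a perturbed Euler step
(`step_contracted`), and the flow becomes `r' = -r² (A r + B)` (`isContinuousTimeLimit_contracted`).
Since `A, B ≥ 0` (`intercept_nonneg`), `r` decreases from 1 within `[0, 1]`.

For large ensembles the strong law makes `A` and `B` converge, and `e` tends to the first basis
vector, because a reflection symmetry of the Gaussian kills the other components
(`integral_smul_stdGaussian`). The limit law is the Gaussian pushed forward by `limitMap`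
(`IsTypical.isLargeEnsembleLimit`).

The limit of `A + B` is positive (`gaussianCov_pos`), so the limiting `r` tends to 0: the safe mass
is projected onto `G = 0` while the failing mass stays put. The limiting mean is thus `-𝔼[G̃]` times
the first basis vector, which `neg_integral_aux` splits into the two terms. -/

namespace EnKF

/-! ### The scalar decay equation -/

/-- A bounded Lipschitz vector field has a global integral curve through every point. -/
theorem exists_forall_hasDerivAt_of_lipschitzWith {E : Type*} [NormedAddCommGroup E]
    [NormedSpace ℝ E] [CompleteSpace E] {f : E → E} {K L : NNReal} (hf : LipschitzWith K f)
    (hL : ∀ x, ‖f x‖ ≤ L) (x₀ : E) :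
    ∃ α : ℝ → E, α 0 = x₀ ∧ ∀ t, HasDerivAt α (f (α t)) t := by
  have key : ∀ n : ℕ, ∃ α : ℝ → E, α 0 = x₀ ∧
      ∀ t ∈ Set.Ioo (-(n + 1 : ℝ)) (n + 1), HasDerivAt α (f (α t)) t := by
    intro n
    have h0 : (0 : ℝ) ∈ Set.Icc (-(n + 1 : ℝ)) (n + 1) := by
      constructor <;> linarith [n.cast_nonneg (α := ℝ)]
    have hp : IsPicardLindelof (fun _ ↦ f) (⟨0, h0⟩ : Set.Icc (-(n + 1 : ℝ)) (n + 1)) x₀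
        (L * (n + 1)) 0 L K :=
      IsPicardLindelof.of_time_independent (fun x _ => hL x) hf.lipschitzOnWith (by simp)
    obtain ⟨α, h1, h2⟩ := hp.exists_eq_forall_mem_Icc_hasDerivWithinAt₀
    exact ⟨α, h1, fun t ht => (h2 t (Set.Ioo_subset_Icc_self ht)).hasDerivAt
      (Icc_mem_nhds ht.1 ht.2)⟩
  choose α hα0 hα using key
  have agree : ∀ (m n : ℕ) (s : ℝ), |s| < m + 1 → |s| < n + 1 → α m s = α n s := by
    intro m n s hm hn
    set R : ℝ := min (m + 1) (n + 1) with hR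
    have hRm : R ≤ m + 1 := min_le_left _ _
    have hRn : R ≤ n + 1 := min_le_right _ _
    have hs : |s| < R := lt_min hm hn
    have hR0 : 0 < R := (abs_nonneg s).trans_lt hs
    have := ODE_solution_unique_of_mem_Ioo (v := fun _ => f) (s := fun _ => Set.univ) (K := K)
      (f := α m) (g := α n) (a := -R) (b := R) (t₀ := 0)
      (fun _ _ => hf.lipschitzOnWith) ⟨by linarith, hR0⟩
      (fun t ht => ⟨hα m t ⟨by linarith [ht.1], by linarith [ht.2]⟩, trivial⟩)
      (fun t ht => ⟨hα n t ⟨by linarith [ht.1], by linarith [ht.2]⟩, trivial⟩)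
      (by rw [hα0, hα0])
    exact this (abs_lt.1 hs)
  -- Solution `n` lives on the open interval of radius `n + 1`, so index `⌈|t|⌉₊` covers a whole
  -- neighbourhood of `t`.
  refine ⟨fun t => α ⌈|t|⌉₊ t, by simp [hα0], fun t => ?_⟩
  set n := ⌈|t|⌉₊
  have ht : |t| < n + 1 := (Nat.le_ceil _).trans_lt (by linarith)
  have hd := hα n t (abs_lt.1 ht)
  refine hd.congr_of_eventuallyEq ?_
  filter_upwards [(continuous_abs.tendsto t).eventually_lt_const ht] with s hs
  exact agree _ _ _ ((Nat.le_ceil _).trans_lt (by linarith)) hs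

/-- The right-hand side of the scalar equation governing the contraction of the ensemble. -/
def decayField (A B x : ℝ) : ℝ := -(x ^ 2 * (A * x + B))

/-- `r` solves `r' = -r² (A r + B)`, `r 0 = 1`, with values in `[0, 1]`. -/
structure IsDecay (A B : ℝ) (r : ℝ → ℝ) : Prop where
  initial : r 0 = 1
  mem : ∀ t, 0 ≤ t → r t ∈ Set.Icc (0 : ℝ) 1
  deriv : ∀ t, 0 ≤ t → HasDerivWithinAt r (decayField A B (r t)) (Set.Ici 0) t

theorem abs_decayField_le {A B x : ℝ} (hA : 0 ≤ A) (hB : 0 ≤ B) (hx : x ∈ Set.Icc (0 : ℝ) 1) :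
    |decayField A B x| ≤ A + B := by
  obtain ⟨h0, h1⟩ := hx
  have hx2 : x ^ 2 ≤ 1 := pow_le_one₀ h0 h1
  have h3 : A * x + B ≤ A + B := by nlinarith
  have h4 : 0 ≤ A * x + B := by positivity
  rw [decayField, abs_neg, abs_of_nonneg (by positivity)]
  nlinarith [sq_nonneg x]

theorem decayField_nonpos {A B x : ℝ} (hA : 0 ≤ A) (hB : 0 ≤ B) (hx : 0 ≤ x) :
    decayField A B x ≤ 0 := by
  unfold decayField
  have : 0 ≤ x ^ 2 * (A * x + B) := by positivity
  linarith

theorem abs_decayField_sub_le {A B x y : ℝ} (hA : 0 ≤ A) (hB : 0 ≤ B)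
    (hx : x ∈ Set.Icc (0 : ℝ) 1) (hy : y ∈ Set.Icc (0 : ℝ) 1) :
    |decayField A B x - decayField A B y| ≤ (3 * A + 2 * B) * |x - y| := by
  obtain ⟨hx0, hx1⟩ := hx
  obtain ⟨hy0, hy1⟩ := hy
  have e : decayField A B x - decayField A B y =
      -((A * (x ^ 2 + x * y + y ^ 2) + B * (x + y)) * (x - y)) := by
    unfold decayField; ring
  rw [e, abs_neg, abs_mul, abs_of_nonneg (by positivity)]
  have h1 : x ^ 2 + x * y + y ^ 2 ≤ 3 := by nlinarith
  have h2 : x + y ≤ 2 := by linarith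
  exact mul_le_mul_of_nonneg_right (by nlinarith) (abs_nonneg _)

theorem lipschitzOnWith_decayField {A B : ℝ} (hA : 0 ≤ A) (hB : 0 ≤ B) :
    LipschitzOnWith (3 * A + 2 * B).toNNReal (decayField A B) (Set.Icc 0 1) := by
  refine LipschitzOnWith.of_dist_le_mul fun x hx y hy => ?_
  rw [Real.coe_toNNReal _ (by positivity), Real.dist_eq, Real.dist_eq]
  exact abs_decayField_sub_le hA hB hx hy

/-- Clamping the argument to `[0, 1]` makes the field bounded and globally Lipschitz. The clamp is
inactive along the solution for `t ≥ 0`: it decreases from 1 and cannot become negative. -/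
theorem exists_isDecay {A B : ℝ} (hA : 0 ≤ A) (hB : 0 ≤ B) : ∃ r, IsDecay A B r := by
  set c : ℝ → ℝ := fun x => max 0 (min 1 x) with hc
  have hcm : ∀ x, c x ∈ Set.Icc (0 : ℝ) 1 := fun x => ⟨by simp [hc], by simp [hc]⟩
  have hcl : LipschitzWith 1 c := (LipschitzWith.id.const_min 1).const_max 0
  have hlip : LipschitzWith (3 * A + 2 * B).toNNReal (fun x => decayField A B (c x)) := by
    refine LipschitzWith.of_dist_le_mul fun x y => ?_
    refine ((lipschitzOnWith_decayField hA hB).dist_le_mul _ (hcm x) _ (hcm y)).trans ?_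
    gcongr
    simpa using hcl.dist_le_mul x y
  obtain ⟨r, hr0, hr⟩ := exists_forall_hasDerivAt_of_lipschitzWith hlip (L := (A + B).toNNReal)
    (fun x => by
      rw [Real.coe_toNNReal _ (by positivity), Real.norm_eq_abs]
      exact abs_decayField_le hA hB (hcm x)) 1
  have hanti : Antitone r := antitone_of_hasDerivAt_nonpos hr
    fun x => decayField_nonpos hA hB (hcm _).1
  have hpos : ∀ t, 0 ≤ r t := by
    intro t
    -- Below 0 the clamped field vanishes, so the constant `r t` is also a solution; uniqueness
    -- backwards in time contradicts `r 0 = 1`.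
    by_contra! hneg
    have hct : c (r t) = 0 := by simp [hc, hneg.le]
    have hu := ODE_solution_unique_univ (v := fun _ x => decayField A B (c x))
      (s := fun _ => Set.univ) (f := r) (g := fun _ => r t) (t₀ := t)
      (fun _ => hlip.lipschitzOnWith) (fun s => ⟨hr s, trivial⟩)
      (fun s => ⟨by simpa [hct, decayField] using hasDerivAt_const s (r t), trivial⟩) rfl
    have := congrFun hu 0
    simp only [hr0] at this
    linarith
  have hmem : ∀ t, 0 ≤ t → r t ∈ Set.Icc (0 : ℝ) 1 := fun t ht => ⟨hpos t, hr0 ▸ hanti ht⟩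
  refine ⟨r, hr0, hmem, fun t ht => ?_⟩
  have hct : c (r t) = r t := by simp [hc, (hmem t ht).1, (hmem t ht).2]
  simpa only [hct] using (hr t).hasDerivWithinAt

namespace IsDecay

variable {A B : ℝ} {r : ℝ → ℝ}

theorem continuousOn (hr : IsDecay A B r) : ContinuousOn r (Set.Ici 0) :=
  fun t ht => (hr.deriv t ht).continuousWithinAt

theorem abs_sub_le (hr : IsDecay A B r) (hA : 0 ≤ A) (hB : 0 ≤ B) {s t : ℝ} (hs : 0 ≤ s)
    (ht : 0 ≤ t) : |r t - r s| ≤ (A + B) * |t - s| :=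
  (convex_Ici (0 : ℝ)).norm_image_sub_le_of_norm_hasDerivWithin_le (f := r)
    (f' := fun τ => decayField A B (r τ)) (fun τ hτ => hr.deriv τ hτ)
    (fun τ hτ => abs_decayField_le hA hB (hr.mem τ hτ)) hs ht

theorem antitoneOn (hr : IsDecay A B r) (hA : 0 ≤ A) (hB : 0 ≤ B) :
    AntitoneOn r (Set.Ici 0) := by
  refine antitoneOn_of_hasDerivWithinAt_nonpos (f' := fun τ => decayField A B (r τ))
    (convex_Ici 0) hr.continuousOn ?_ ?_
  · intro x hx
    exact (hr.deriv x (interior_subset hx)).mono interior_subset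
  · intro x hx
    exact decayField_nonpos hA hB (hr.mem x (interior_subset hx)).1

/-- On `[0, 1]` one has `x² (A x + B) ≥ (A + B) x³`, and `r ≥ r t` on `[0, t]`; hence `r` falls
there at rate at least `(A + B) r(t)³`, but by at most 1 in total. This yields decay without solving
the equation. -/
theorem mul_pow_three_le (hr : IsDecay A B r) (hA : 0 ≤ A) (hB : 0 ≤ B) {t : ℝ} (ht : 0 ≤ t) :
    (A + B) * r t ^ 3 * t ≤ 1 := by
  have hanti : AntitoneOn (fun s => r s + (A + B) * r t ^ 3 * s) (Set.Icc 0 t) := by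
    have hd : ∀ x ∈ Set.Icc 0 t, HasDerivWithinAt (fun s => r s + (A + B) * r t ^ 3 * s)
        (decayField A B (r x) + (A + B) * r t ^ 3) (Set.Icc 0 t) x := fun x hx => by
      have h1 := (hr.deriv x hx.1).mono 
        (show Set.Icc 0 t ⊆ Set.Ici 0 from Set.Icc_subset_Ici_self)
      have h2 := ((hasDerivAt_id x).const_mul ((A + B) * r t ^ 3)).hasDerivWithinAt
        (s := Set.Icc 0 t)
      simpa using h1.fun_add h2
    refine antitoneOn_of_hasDerivWithinAt_nonpos
      (f' := fun x => decayField A B (r x) + (A + B) * r t ^ 3) (convex_Icc 0 t)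
      (fun x hx => (hd x hx).continuousWithinAt) ?_ ?_
    · intro x hx
      exact (hd x (interior_subset hx)).mono interior_subset
    · intro x hx
      have hx := interior_subset hx
      have hle : r t ≤ r x := hr.antitoneOn hA hB hx.1 ht hx.2
      have h0 := (hr.mem t ht).1
      have hxm := hr.mem x hx.1
      have h3 : r t ^ 3 ≤ r x ^ 3 := by gcongr
      have h4 : r x ^ 3 ≤ r x ^ 2 := pow_le_pow_of_le_one hxm.1 hxm.2 (by norm_num)
      unfold decayField
      nlinarith
  have := hanti ⟨le_rfl, ht⟩ ⟨ht, le_rfl⟩ ht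
  simp only [hr.initial, mul_zero, add_zero] at this
  linarith [(hr.mem t ht).1]

theorem tendsto_atTop (hr : IsDecay A B r) (hA : 0 ≤ A) (hB : 0 ≤ B) (hAB : 0 < A + B) :
    Tendsto r atTop (𝓝 0) := by
  have h3 : Tendsto (fun t => r t ^ 3) atTop (𝓝 0) := by
    have hlim : Tendsto (fun t : ℝ => (A + B)⁻¹ * t⁻¹) atTop (𝓝 0) := by
      simpa using tendsto_inv_atTop_zero.const_mul (A + B)⁻¹
    refine tendsto_of_tendsto_of_tendsto_of_le_of_le' tendsto_const_nhds hlim ?_ ?_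
    · filter_upwards [eventually_ge_atTop 0] with t ht using pow_nonneg (hr.mem t ht).1 3
    · filter_upwards [eventually_gt_atTop 0] with t ht
      rw [← mul_inv, ← one_div, le_div_iff₀ (by positivity)]
      linarith [hr.mul_pow_three_le hA hB ht.le]
  rw [Metric.tendsto_nhds] at h3 ⊢
  intro ε hε
  filter_upwards [h3 (ε ^ 3) (by positivity), eventually_ge_atTop 0] with t ht ht0
  have h0 := (hr.mem t ht0).1
  rw [Real.dist_eq, sub_zero, abs_of_nonneg (by positivity)] at ht
  rw [Real.dist_eq, sub_zero, abs_of_nonneg h0]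
  exact lt_of_pow_lt_pow_left₀ 3 hε.le ht

/-- The solution depends continuously on the coefficients. -/
theorem tendsto_of_tendsto {ι : Type*} {l : Filter ι} {A' B' : ι → ℝ} {r' : ι → ℝ → ℝ}
    (hr : IsDecay A B r) (hA : 0 ≤ A) (hB : 0 ≤ B)
    (hr' : ∀ i, IsDecay (A' i) (B' i) (r' i)) (hA' : Tendsto A' l (𝓝 A))
    (hB' : Tendsto B' l (𝓝 B)) {t : ℝ} (ht : 0 ≤ t) :
    Tendsto (fun i => r' i t) l (𝓝 (r t)) := by
  set K := (3 * A + 2 * B).toNNReal with hK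
  have hsub : ∀ s ∈ Set.Ico 0 t, Set.Ici s ⊆ Set.Ici 0 := fun s hs => Set.Ici_subset_Ici.2 hs.1
  have hbound : ∀ i, dist (r' i t) (r t) ≤ gronwallBound 0 K (|A' i - A| + |B' i - B| + 0) t := by
    intro i
    -- `r' i` is an approximate trajectory of the limiting field: on `[0, 1]` the two fields differ
    -- by at most `|A' i - A| + |B' i - B|`.
    have := dist_le_of_approx_trajectories_ODE_of_mem (v := fun _ => decayField A B)
      (s := fun _ => Set.Icc 0 1) (K := K) (a := 0) (b := t) (f := r' i) (g := r)
      (f' := fun s => decayField (A' i) (B' i) (r' i s)) (g' := fun s => decayField A B (r s))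
      (εf := |A' i - A| + |B' i - B|) (εg := 0) (δ := 0)
      (fun _ _ => lipschitzOnWith_decayField hA hB)
      ((hr' i).continuousOn.mono Set.Icc_subset_Ici_self)
      (fun s hs => ((hr' i).deriv s hs.1).mono (hsub s hs)) ?_
      (fun s hs => (hr' i).mem s hs.1) (hr.continuousOn.mono Set.Icc_subset_Ici_self)
      (fun s hs => (hr.deriv s hs.1).mono (hsub s hs)) (by simp)
      (fun s hs => hr.mem s hs.1) (by simp [(hr' i).initial, hr.initial]) t ⟨ht, le_rfl⟩
    · simpa using this
    · intro s hs
      obtain ⟨h0, h1⟩ := (hr' i).mem s hs.1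
      set x := r' i s
      have e : decayField (A' i) (B' i) x - decayField A B x =
          -(x ^ 3 * (A' i - A) + x ^ 2 * (B' i - B)) := by unfold decayField; ring
      rw [Real.dist_eq, e, abs_neg]
      refine (abs_add_le _ _).trans ?_
      rw [abs_mul, abs_mul, abs_of_nonneg (pow_nonneg h0 3), abs_of_nonneg (pow_nonneg h0 2)]
      exact add_le_add (mul_le_of_le_one_left (abs_nonneg _) (pow_le_one₀ h0 h1))
        (mul_le_of_le_one_left (abs_nonneg _) (pow_le_one₀ h0 h1))
  have hε : Tendsto (fun i => |A' i - A| + |B' i - B| + 0) l (𝓝 0) := by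
    have h1 := (hA'.sub_const A).abs
    have h2 := (hB'.sub_const B).abs
    simpa using h1.add h2
  have hlim := ((gronwallBound_continuous_ε 0 K t).tendsto 0).comp hε
  rw [gronwallBound_ε0_δ0] at hlim
  exact tendsto_iff_dist_tendsto_zero.2
    (squeeze_zero (fun _ => dist_nonneg) hbound hlim)

end IsDecay

/-! ### Convergence of the discrete contraction factors -/

/-- The update of the contraction factor in one EnKF step of size `h`. -/
noncomputable def decayStep (A B h x : ℝ) : ℝ := x + h / (1 + h * (x ^ 2 * A)) * decayField A B x

/-- The step multiplies `x` by `1 - q x (A x + B)` with `0 ≤ q ≤ h`, and `h (A + B) ≤ 1` keeps this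
factor in `[0, 1]`. -/
theorem decayStep_mem_Icc {A B h x : ℝ} (hA : 0 ≤ A) (hB : 0 ≤ B) (hh : 0 ≤ h)
    (hhAB : h * (A + B) ≤ 1) (hx : x ∈ Set.Icc (0 : ℝ) 1) :
    decayStep A B h x ∈ Set.Icc (0 : ℝ) 1 := by
  obtain ⟨h0, h1⟩ := hx
  have hq0 : 0 ≤ h / (1 + h * (x ^ 2 * A)) := by positivity
  have hq1 : h / (1 + h * (x ^ 2 * A)) ≤ h :=
    div_le_self hh (le_add_of_nonneg_right (by positivity))
  set q := h / (1 + h * (x ^ 2 * A))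
  have e : decayStep A B h x = x * (1 - q * (x * (A * x + B))) := by
    simp only [decayStep, decayField]; ring
  have hf : x * (A * x + B) ≤ A + B := by
    have h3 : A * x + B ≤ A + B := by nlinarith
    have h4 : 0 ≤ A * x + B := by positivity
    nlinarith
  have hf0 : 0 ≤ x * (A * x + B) := by positivity
  have hqf : q * (x * (A * x + B)) ≤ 1 :=
    (mul_le_mul hq1 hf hf0 hh).trans hhAB
  have hqf0 : 0 ≤ q * (x * (A * x + B)) := by positivity
  rw [e]
  exact ⟨mul_nonneg h0 (by linarith), mul_le_one₀ h1 (by linarith) (by linarith)⟩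

theorem iterate_decayStep_mem_Icc {A B h : ℝ} (hA : 0 ≤ A) (hB : 0 ≤ B) (hh : 0 ≤ h)
    (hhAB : h * (A + B) ≤ 1) (n : ℕ) : (decayStep A B h)^[n] 1 ∈ Set.Icc (0 : ℝ) 1 := by
  induction n with
  | zero => simp
  | succ n ih =>
    rw [Function.iterate_succ_apply']
    exact decayStep_mem_Icc hA hB hh hhAB ih

/-- The step differs from explicit Euler only through the denominator `1 + h x² A`, a second-order
effect in `h`. -/
theorem abs_decayStep_sub_le {A B h x : ℝ} (hA : 0 ≤ A) (hB : 0 ≤ B) (hh : 0 ≤ h)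
    (hx : x ∈ Set.Icc (0 : ℝ) 1) :
    |decayStep A B h x - (x + h * decayField A B x)| ≤ h ^ 2 * (A * (A + B)) := by
  have hf := abs_decayField_le hA hB hx
  obtain ⟨h0, h1⟩ := hx
  have hx2 : x ^ 2 ≤ 1 := pow_le_one₀ h0 h1
  have hd : 0 < 1 + h * (x ^ 2 * A) := by positivity
  have e : decayStep A B h x - (x + h * decayField A B x) =
      -(h ^ 2 * (x ^ 2 * A) / (1 + h * (x ^ 2 * A)) * decayField A B x) := by
    unfold decayStep; field_simp; ring
  rw [e, abs_neg, abs_mul, abs_of_nonneg (by positivity),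
    show h ^ 2 * (A * (A + B)) = h ^ 2 * A * (A + B) by ring]
  have hq : h ^ 2 * (x ^ 2 * A) / (1 + h * (x ^ 2 * A)) ≤ h ^ 2 * A := by
    refine (div_le_self (by positivity) (le_add_of_nonneg_right (by positivity))).trans ?_
    gcongr
    nlinarith
  exact mul_le_mul hq hf (abs_nonneg _) (by positivity)

namespace IsDecay

variable {A B : ℝ} {r : ℝ → ℝ}

/-- Local Euler error: the mean value inequality applied to `r` minus its tangent at `s`. -/
theorem abs_sub_euler_le (hr : IsDecay A B r) (hA : 0 ≤ A) (hB : 0 ≤ B) {s h : ℝ} (hs : 0 ≤ s)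
    (hh : 0 ≤ h) :
    |r (s + h) - (r s + h * decayField A B (r s))| ≤
      h ^ 2 * ((3 * A + 2 * B) * (A + B)) := by
  have hd : ∀ x ∈ Set.Icc s (s + h), HasDerivWithinAt (fun τ => r τ - τ * decayField A B (r s))
      (decayField A B (r x) - decayField A B (r s)) (Set.Icc s (s + h)) x := fun x hx => by
    have h1 := (hr.deriv x (hs.trans hx.1)).mono
      (show Set.Icc s (s + h) ⊆ Set.Ici 0 from fun y hy => hs.trans hy.1)
    have h2 := ((hasDerivAt_id x).mul_const (decayField A B (r s))).hasDerivWithinAt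
      (s := Set.Icc s (s + h))
    simpa using h1.fun_sub h2
  have hb : ∀ x ∈ Set.Icc s (s + h), ‖decayField A B (r x) - decayField A B (r s)‖ ≤
      (3 * A + 2 * B) * ((A + B) * h) := fun x hx => by
    rw [Real.norm_eq_abs]
    refine (abs_decayField_sub_le hA hB (hr.mem x (hs.trans hx.1)) (hr.mem s hs)).trans ?_
    gcongr
    refine (hr.abs_sub_le hA hB hs (hs.trans hx.1)).trans ?_
    gcongr
    rw [abs_of_nonneg (by linarith [hx.1])]
    linarith [hx.2]
  have := (convex_Icc s (s + h)).norm_image_sub_le_of_norm_hasDerivWithin_le hd hb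
    (Set.left_mem_Icc.2 (by linarith)) (Set.right_mem_Icc.2 (by linarith))
  simp only [Real.norm_eq_abs, add_sub_cancel_left, abs_of_nonneg hh] at this
  convert this using 1
  · congr 1; ring
  · ring

theorem abs_iterate_decayStep_sub_le (hr : IsDecay A B r) (hA : 0 ≤ A) (hB : 0 ≤ B) {h : ℝ}
    (hh : 0 ≤ h) (hhAB : h * (A + B) ≤ 1) (n : ℕ) :
    |(decayStep A B h)^[n] 1 - r (n * h)| ≤
      n * (h ^ 2 * ((4 * A + 2 * B) * (A + B))) * Real.exp (n * (h * (3 * A + 2 * B))) := by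
  -- The constant adds `A (A + B)` from the denominator to `(3 A + 2 B) (A + B)` from the Euler
  -- error.
  have := discrete_gronwall (u := fun n : ℕ => |(decayStep A B h)^[n] 1 - r (n * h)|)
    (b := fun _ => h ^ 2 * ((4 * A + 2 * B) * (A + B))) (c := fun _ => h * (3 * A + 2 * B))
    (n₀ := 0) (abs_nonneg _) ?_ (fun _ _ => by positivity) (fun _ _ => by positivity)
    (Nat.zero_le n)
  · simpa [hr.initial] using this
  · intro n _
    have hx := iterate_decayStep_mem_Icc hA hB hh hhAB n
    have hn : 0 ≤ (n : ℝ) * h := by positivity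
    rw [Function.iterate_succ_apply']
    set x := (decayStep A B h)^[n] 1
    have h1 := abs_decayStep_sub_le hA hB hh hx
    have h2 := hr.abs_sub_euler_le hA hB hn hh
    have h3 := abs_decayField_sub_le hA hB hx (hr.mem _ hn)
    have e : ((n + 1 : ℕ) : ℝ) * h = n * h + h := by push_cast; ring
    rw [e]
    set y := r (n * h)
    have h4 : |h * (decayField A B x - decayField A B y)| ≤ h * ((3 * A + 2 * B) * |x - y|) := by
      rw [abs_mul, abs_of_nonneg hh]
      gcongr
    calc |decayStep A B h x - r (n * h + h)|
        = |(decayStep A B h x - (x + h * decayField A B x)) -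
            (r (n * h + h) - (y + h * decayField A B y)) + (x - y) +
            h * (decayField A B x - decayField A B y)| := by congr 1; ring
      _ ≤ |decayStep A B h x - (x + h * decayField A B x)| +
            |r (n * h + h) - (y + h * decayField A B y)| + |x - y| +
            |h * (decayField A B x - decayField A B y)| :=
          (abs_add_le _ _).trans (add_le_add_left ((abs_add_le _ _).trans
            (add_le_add_left (abs_sub _ _) _)) _)
      _ ≤ _ := by linarith

/-- The discrete contraction factors converge to the solution of the scalar equation. -/
theorem tendsto_iterate_decayStep (hr : IsDecay A B r) (hA : 0 ≤ A) (hB : 0 ≤ B) {t : ℝ}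
    (ht : 0 ≤ t) :
    Tendsto (fun h : ℝ => (decayStep A B h)^[⌊t / h⌋₊] 1) (𝓝[>] 0) (𝓝 (r t)) := by
  set C := (4 * A + 2 * B) * (A + B) with hC
  have hC0 : 0 ≤ C := by positivity
  have hlim : Tendsto (fun h : ℝ => h * (t * C * Real.exp (t * (3 * A + 2 * B)) + (A + B)))
      (𝓝[>] 0) (𝓝 0) := by
    have := ((continuous_id.mul continuous_const).tendsto' (0 : ℝ) 0
      (by simp) : Tendsto (fun h : ℝ => h * (t * C * Real.exp (t * (3 * A + 2 * B)) + (A + B)))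
      (𝓝 0) (𝓝 0))
    exact this.mono_left nhdsWithin_le_nhds
  have hsmall : ∀ᶠ h : ℝ in 𝓝[>] 0, h * (A + B) ≤ 1 := by
    have : Tendsto (fun h : ℝ => h * (A + B)) (𝓝[>] 0) (𝓝 0) :=
      ((continuous_id.mul continuous_const).tendsto' (0 : ℝ) 0 (by simp)).mono_left
        nhdsWithin_le_nhds
    exact (this.eventually_lt_const one_pos).mono fun _ h => h.le
  refine tendsto_iff_dist_tendsto_zero.2 (squeeze_zero' (.of_forall fun _ => dist_nonneg) ?_ hlim)
  filter_upwards [hsmall, self_mem_nhdsWithin] with h hs (hpos : 0 < h)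
  set n := ⌊t / h⌋₊
  have hn : (n : ℝ) * h ≤ t := (le_div_iff₀ hpos).1 (Nat.floor_le (by positivity))
  have hn' : t - h ≤ n * h := by
    have := (div_lt_iff₀ hpos).1 (Nat.lt_floor_add_one (t / h))
    linarith
  have h1 := hr.abs_iterate_decayStep_sub_le hA hB hpos.le hs n
  have h2 := hr.abs_sub_le hA hB ht (show 0 ≤ n * h by positivity)
  have h3 : |n * h - t| ≤ h := abs_le.2 ⟨by linarith, by linarith⟩
  have h4 : n * (h ^ 2 * C) * Real.exp (n * (h * (3 * A + 2 * B))) ≤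
      h * (t * C * Real.exp (t * (3 * A + 2 * B))) := by
    have e1 : n * (h ^ 2 * C) = (n * h) * C * h := by ring
    have e2 : n * (h * (3 * A + 2 * B)) = (n * h) * (3 * A + 2 * B) := by ring
    rw [e1, e2]
    calc (n * h) * C * h * Real.exp ((n * h) * (3 * A + 2 * B))
        ≤ t * C * h * Real.exp (t * (3 * A + 2 * B)) := by gcongr
      _ = _ := by ring
  have h5 : (A + B) * |n * h - t| ≤ (A + B) * h := by gcongr
  rw [Real.dist_eq]
  calc |(decayStep A B h)^[n] 1 - r t|
      ≤ |(decayStep A B h)^[n] 1 - r (n * h)| + |r (n * h) - r t| := _root_.abs_sub_le _ _ _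
    _ ≤ _ := by linarith

end IsDecay

end EnKF

/-! ### Ensemble averages and empirical covariances -/

namespace EnKF

section Averages

variable {E : Type*} [AddCommGroup E] [Module ℝ E] {J : ℕ}

theorem avg_sub (f g : Fin J → E) : avg (fun k => f k - g k) = avg f - avg g := by
  simp [avg, Finset.sum_sub_distrib, smul_sub]

theorem avg_const_smul (c : ℝ) (f : Fin J → E) : avg (fun k => c • f k) = c • avg f := by
  simp [avg, ← Finset.smul_sum, smul_comm c]

theorem avg_smul_const (f : Fin J → ℝ) (e : E) : avg (fun k => f k • e) = avg f • e := by
  simp [avg, ← Finset.sum_smul, smul_smul]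

theorem avg_mul_const (f : Fin J → ℝ) (c : ℝ) : avg (fun k => f k * c) = avg f * c :=
  avg_smul_const f c

theorem avg_const_mul (c : ℝ) (f : Fin J → ℝ) : avg (fun k => c * f k) = c * avg f :=
  avg_const_smul c f

theorem avg_const (hJ : J ≠ 0) (e : E) : avg (fun _ : Fin J => e) = e := by
  have : (J : ℝ) ≠ 0 := by exact_mod_cast hJ
  simp [avg, ← Nat.cast_smul_eq_nsmul ℝ, smul_smul, this]

theorem avg_nonneg {f : Fin J → ℝ} (hf : ∀ k, 0 ≤ f k) : 0 ≤ avg f :=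
  smul_nonneg (by positivity) (Finset.sum_nonneg fun k _ => hf k)

theorem avg_le_avg {f g : Fin J → ℝ} (h : ∀ k, f k ≤ g k) : avg f ≤ avg g :=
  smul_le_smul_of_nonneg_left (Finset.sum_le_sum fun k _ => h k) (by positivity)

theorem abs_avg_le (f : Fin J → ℝ) : |avg f| ≤ avg fun k => |f k| := by
  simp only [avg, smul_eq_mul]
  rw [abs_mul, abs_of_nonneg (by positivity : 0 ≤ (J : ℝ)⁻¹)]
  gcongr
  exact Finset.abs_sum_le_sum_abs _ _

theorem avg_apply {d : ℕ} (f : Fin J → Space d) (i : Fin d) : avg f i = avg fun k => f k i := by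
  simp [avg]

theorem avg_eq_sum_range (f : ℕ → E) :
    avg (fun k : Fin J => f k) = (J : ℝ)⁻¹ • ∑ k ∈ Finset.range J, f k := by
  rw [avg, Fin.sum_univ_eq_sum_range]

/-- The empirical covariance of a scalar and a vector-valued sample. -/
noncomputable def ecov (p : Fin J → ℝ) (q : Fin J → E) : E :=
  avg fun k => (p k - avg p) • (q k - avg q)

theorem ecov_eq (p : Fin J → ℝ) (q : Fin J → E) :
    ecov p q = (avg fun k => p k • q k) - avg p • avg q := by
  rcases eq_or_ne J 0 with rfl | hJ
  · simp [ecov, avg]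
  have e : ∀ k, (p k - avg p) • (q k - avg q) =
      (p k • q k - avg p • q k) - (p k • avg q - avg p • avg q) := fun k => by
    rw [sub_smul, smul_sub, smul_sub]; abel
  simp only [ecov, e, avg_sub, avg_const_smul, avg_smul_const, avg_const hJ]
  simp

theorem ecov_const_mul_left (c : ℝ) (p : Fin J → ℝ) (q : Fin J → E) :
    ecov (fun k => c * p k) q = c • ecov p q := by
  simp only [ecov_eq, avg_const_mul, mul_smul, avg_const_smul, smul_sub]

theorem ecov_const_mul_right (c : ℝ) (p q : Fin J → ℝ) :
    ecov p (fun k => c * q k) = c * ecov p q := by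
  simp only [ecov_eq, smul_eq_mul, mul_left_comm _ c, avg_const_mul, mul_sub]

theorem ecov_sub_right (p : Fin J → ℝ) (q q' : Fin J → E) :
    ecov p (fun k => q k - q' k) = ecov p q - ecov p q' := by
  simp only [ecov_eq, smul_sub, avg_sub]
  abel

theorem ecov_smul_const_right (p q : Fin J → ℝ) (e : E) :
    ecov p (fun k => q k • e) = ecov p q • e := by
  simp only [ecov_eq, smul_smul, avg_smul_const, sub_smul, smul_eq_mul]

theorem ecov_self_nonneg (p : Fin J → ℝ) : 0 ≤ ecov p p :=
  avg_nonneg fun _ => mul_self_nonneg _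

theorem ecov_eq_zero_of_ecov_self_eq_zero {p : Fin J → ℝ} (hp : ecov p p = 0) (q : Fin J → E) :
    ecov p q = 0 := by
  rcases eq_or_ne J 0 with rfl | hJ
  · simp [ecov, avg]
  have hJ' : (J : ℝ)⁻¹ ≠ 0 := inv_ne_zero (by exact_mod_cast hJ)
  have hsum : ∑ k, (p k - avg p) * (p k - avg p) = 0 := by
    simpa [ecov, avg, hJ'] using hp
  rw [Finset.sum_eq_zero_iff_of_nonneg fun _ _ => mul_self_nonneg _] at hsum
  have h0 : ∀ k, p k - avg p = 0 := fun k => mul_self_eq_zero.1 (hsum k (Finset.mem_univ k))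
  simp only [ecov, h0, zero_smul]
  simp [avg]

theorem ecov_apply {d : ℕ} (p : Fin J → ℝ) (q : Fin J → Space d) (i : Fin d) :
    ecov p q i = ecov p fun k => q k i := by
  simp [ecov, avg_apply]

theorem covUP_eq_ecov {d : ℕ} (g : Space d → ℝ) (u : Fin J → Space d) :
    covUP g u = ecov (fun k => g (u k)) u := rfl

theorem covPP_eq_ecov {d : ℕ} (g : Space d → ℝ) (u : Fin J → Space d) :
    covPP g u = ecov (fun k => g (u k)) fun k => g (u k) := by
  simp [covPP, ecov, sq]

end Averages

/-! ### Reduction of the ensemble to one contraction factor -/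

section Ensemble

variable {d J : ℕ} [NeZero d] (b : ℝ) (U : Fin J → Space d)

/-- The values of `G̃` on an ensemble. -/
noncomputable def obs (k : Fin J) : ℝ := aux (affineLSF d b) (U k)

/-- The slope of the scalar decay equation of an ensemble. -/
noncomputable def slope : ℝ := ecov (obs b U) (obs b U)

/-- The intercept of the scalar decay equation of an ensemble. -/
noncomputable def intercept : ℝ := ecov (obs b U) (fun k => U k 0) - slope b U

theorem obs_nonneg (k : Fin J) : 0 ≤ obs b U k := le_max_left _ _

theorem slope_nonneg : 0 ≤ slope b U := ecov_self_nonneg _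

theorem slope_add_intercept : slope b U + intercept b U = ecov (obs b U) U 0 := by
  rw [intercept, ecov_apply]; ring

/-- The intercept is the covariance of `G̃` with `min(0, G)`, up to a constant shift. Their product
vanishes pointwise, leaving minus the product of a nonnegative and a nonpositive mean. -/
theorem intercept_nonneg : 0 ≤ intercept b U := by
  rw [intercept, slope, ← ecov_sub_right]
  rcases eq_or_ne J 0 with rfl | hJ
  · simp [ecov, avg]
  have e : ecov (obs b U) (fun k => U k 0 - obs b U k) =
      ecov (obs b U) (fun k => (U k 0 - obs b U k) - b) := by
    simp only [ecov, avg_sub _ (fun _ => b), avg_const hJ, sub_sub_sub_cancel_right]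
  have h0 : ∀ k, obs b U k • ((U k 0 - obs b U k) - b) = 0 := fun k => by
    simp only [obs, aux, affineLSF, smul_eq_mul]
    rcases max_cases 0 ((U k) 0 - b) with ⟨h, _⟩ | ⟨h, _⟩ <;> rw [h] <;> ring
  have h1 : ∀ k, (U k 0 - obs b U k) - b ≤ 0 := fun k => by
    have : (U k) 0 - b ≤ obs b U k := le_max_right _ _
    linarith
  have h2 : 0 ≤ avg fun k => -((U k 0 - obs b U k) - b) := avg_nonneg fun k => by linarith [h1 k]
  have h3 : (avg fun k => -((U k 0 - obs b U k) - b)) = -avg fun k => (U k 0 - obs b U k) - b := by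
    simp only [avg, Finset.sum_neg_distrib, smul_neg]
  have h4 := avg_nonneg (obs_nonneg b U)
  rw [e, ecov_eq]
  simp only [h0]
  simp only [avg, Finset.sum_const_zero, smul_zero, zero_sub] at h2 h3 h4 ⊢
  rw [h3] at h2
  rw [← smul_neg]
  exact mul_nonneg h4 h2

/-- All particles move along one common direction. -/
theorem exists_direction :
    ∃ e : Space d, e 0 = 1 ∧ ecov (obs b U) U = (slope b U + intercept b U) • e := by
  rw [slope_add_intercept]
  -- Here `A + B = 0` forces `A = 0`, so `G̃` is constant on the ensemble, the whole covariance
  -- vanishes, and any `e` with `e 0 = 1` serves.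
  by_cases h : ecov (obs b U) U 0 = 0
  · refine ⟨EuclideanSpace.single 0 1, by simp, ?_⟩
    have hs : slope b U = 0 := by
      linarith [slope_add_intercept b U, slope_nonneg b U, intercept_nonneg b U]
    rw [h, zero_smul]
    exact ecov_eq_zero_of_ecov_self_eq_zero hs _
  · exact ⟨(ecov (obs b U) U 0)⁻¹ • ecov (obs b U) U, by simp [h], by simp [smul_smul, h]⟩

/-- The ensemble whose particles have been moved along `e`, contracting `G̃` by the factor `ρ`. -/
noncomputable def contracted (e : Space d) (ρ : ℝ) (j : Fin J) : Space d :=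
  U j - ((1 - ρ) * obs b U j) • e

variable {b U} {e : Space d}

/-- As `e 0 = 1`, a safe particle has `G` scaled by `ρ`, and `ρ ≥ 0` keeps it safe; a failing
particle does not move. -/
theorem aux_contracted (he : e 0 = 1) {ρ : ℝ} (h0 : 0 ≤ ρ) (j : Fin J) :
    aux (affineLSF d b) (contracted b U e ρ j) = ρ * obs b U j := by
  simp only [contracted, aux, affineLSF, obs, PiLp.sub_apply, PiLp.smul_apply, he, smul_eq_mul,
    mul_one]
  rcases le_total 0 ((U j) 0 - b) with h | h
  · rw [max_eq_right h, max_eq_right (by nlinarith)]; ring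
  · rw [max_eq_left h, max_eq_left (by linarith)]; ring

theorem covUP_contracted (he : e 0 = 1)
    (hD : ecov (obs b U) U = (slope b U + intercept b U) • e) {ρ : ℝ} (h0 : 0 ≤ ρ) :
    covUP (aux (affineLSF d b)) (contracted b U e ρ) =
      (ρ * (slope b U * ρ + intercept b U)) • e := by
  simp only [covUP_eq_ecov, aux_contracted he h0, ecov_const_mul_left]
  have : ecov (obs b U) (contracted b U e ρ) = (slope b U * ρ + intercept b U) • e := by
    unfold contracted
    rw [ecov_sub_right, ecov_smul_const_right, hD, ecov_const_mul_right, ← slope, ← sub_smul]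
    congr 1; ring
  rw [show ecov (fun k => obs b U k) (contracted b U e ρ) = _ from this, smul_smul]

theorem covPP_contracted (he : e 0 = 1) {ρ : ℝ} (h0 : 0 ≤ ρ) :
    covPP (aux (affineLSF d b)) (contracted b U e ρ) = ρ ^ 2 * slope b U := by
  simp only [covPP_eq_ecov, aux_contracted he h0, ecov_const_mul_left, ecov_const_mul_right,
    smul_eq_mul, slope]
  ring

theorem step_contracted (he : e 0 = 1)
    (hD : ecov (obs b U) U = (slope b U + intercept b U) • e) {ρ h : ℝ} (h0 : 0 ≤ ρ) (hh : 0 < h) :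
    step (affineLSF d b) h (contracted b U e ρ) =
      contracted b U e (decayStep (slope b U) (intercept b U) h ρ) := by
  ext1 j
  have hs := slope_nonneg b U
  have hne : 1 + h * (ρ ^ 2 * slope b U) ≠ 0 := by positivity
  have hinv : (ρ ^ 2 * slope b U + 1 / h)⁻¹ = h / (1 + h * (ρ ^ 2 * slope b U)) := by
    rw [inv_eq_one_div, div_eq_div_iff (by positivity) hne]
    field_simp
    ring
  rw [step, covUP_contracted he hD h0, covPP_contracted he h0, aux_contracted he h0, hinv,
    contracted, contracted, smul_smul, sub_add, ← sub_smul, decayStep, decayField]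
  congr 2
  ring

/-- The bound on `h` keeps every factor nonnegative, without which the invariance of the family
would fail. -/
theorem iter_eq_contracted (he : e 0 = 1)
    (hD : ecov (obs b U) U = (slope b U + intercept b U) • e) {h : ℝ} (hh : 0 < h)
    (hs : h * (slope b U + intercept b U) ≤ 1) (n : ℕ) :
    iter (affineLSF d b) h U n =
      contracted b U e ((decayStep (slope b U) (intercept b U) h)^[n] 1) := by
  induction n with
  | zero => ext1 j; simp [iter, contracted]
  | succ n ih =>
    have hm := iterate_decayStep_mem_Icc (slope_nonneg b U) (intercept_nonneg b U) hh.le hs n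
    rw [iter] at ih ⊢
    rw [Function.iterate_succ_apply', Function.iterate_succ_apply', ih,
      step_contracted he hD hm.1 hh]

theorem isContinuousTimeLimit_contracted (he : e 0 = 1)
    (hD : ecov (obs b U) U = (slope b U + intercept b U) • e) {r : ℝ → ℝ}
    (hr : IsDecay (slope b U) (intercept b U) r) :
    IsContinuousTimeLimit (affineLSF d b) U (fun t => contracted b U e (r t)) where
  initial := by ext1 j; simp [contracted, hr.initial]
  flow t ht j := by
    have h0 := (hr.mem t ht).1
    have hrhs : (avg fun k => ((aux (affineLSF d b) (contracted b U e (r t) k) -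
        avg fun i => aux (affineLSF d b) (contracted b U e (r t) i)) *
          (-aux (affineLSF d b) (contracted b U e (r t) j))) •
            (contracted b U e (r t) k - avg (contracted b U e (r t)))) =
        (decayField (slope b U) (intercept b U) (r t) * obs b U j) • e := by
      simp_rw [mul_comm _ (-aux (affineLSF d b) (contracted b U e (r t) j)), mul_smul _ _ (_ - _)]
      rw [avg_const_smul, ← covUP, covUP_contracted he hD h0, aux_contracted he h0, smul_smul,
        decayField]
      congr 1; ring
    rw [hrhs]
    have hd := ((((hr.deriv t ht).const_sub 1).mul_const (obs b U j)).smul_const e).const_sub (U j)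
    rw [neg_mul, neg_smul, neg_neg] at hd
    exact hd
  limit t ht := by
    have hlim := hr.tendsto_iterate_decayStep (slope_nonneg b U) (intercept_nonneg b U) ht
    have hc : Continuous (contracted b U e) := by
      unfold contracted
      fun_prop
    refine ((hc.tendsto _).comp hlim).congr' ?_
    have hsmall : Tendsto (fun h : ℝ => h * (slope b U + intercept b U)) (𝓝[>] 0) (𝓝 0) :=
      ((continuous_id.mul continuous_const).tendsto' (0 : ℝ) 0 (by simp)).mono_left
        nhdsWithin_le_nhds
    filter_upwards [hsmall.eventually_lt_const one_pos, self_mem_nhdsWithin] with h hs hpos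
    exact (iter_eq_contracted he hD hpos hs.le _).symm

end Ensemble

end EnKF

/-! ### Weak convergence of empirical measures -/

namespace EnKF

section Empirical

variable {X : Type*} [MeasurableSpace X]

/-- The empirical measure of a nonempty ensemble. -/
noncomputable def empirical {J : ℕ} (v : Fin (J + 1) → X) : ProbabilityMeasure X :=
  ⟨((J + 1 : ℕ) : ENNReal)⁻¹ • ∑ k, Measure.dirac (v k), ⟨by
    simpa using ENNReal.inv_mul_cancel (by simp) (by finiteness)⟩⟩

theorem integral_empirical [MeasurableSingletonClass X] {J : ℕ} (v : Fin (J + 1) → X)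
    (f : X → ℝ) : ∫ x, f x ∂(empirical v : Measure X) = avg fun k => f (v k) := by
  have : ((empirical v : ProbabilityMeasure X) : Measure X) =
      ((J + 1 : ℕ) : ENNReal)⁻¹ • ∑ k, Measure.dirac (v k) := rfl
  rw [this, integral_smul_measure,
    integral_finsetSum_measure fun _ _ => integrable_dirac (by finiteness)]
  simp only [integral_dirac, avg, ENNReal.toReal_inv, ENNReal.toReal_natCast]

/-- Bounded Lipschitz test functions suffice for the weak convergence of empirical measures. -/
theorem tendsto_avg_of_lipschitz {X : Type*} [PseudoEMetricSpace X] [MeasurableSpace X]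
    [OpensMeasurableSpace X] [MeasurableSingletonClass X]
    {v : (J : ℕ) → Fin J → X} {μ : ProbabilityMeasure X}
    (h : ∀ f : BoundedContinuousFunction X ℝ, (∃ L, LipschitzWith L f) →
      Tendsto (fun J => avg fun j => f (v J j)) atTop (𝓝 (∫ x, f x ∂(μ : Measure X))))
    (f : BoundedContinuousFunction X ℝ) :
    Tendsto (fun J => avg fun j => f (v J j)) atTop (𝓝 (∫ x, f x ∂(μ : Measure X))) := by
  -- The index is shifted because an empty ensemble has no empirical probability measure.
  have hT : Tendsto (fun J => empirical (v (J + 1))) atTop (𝓝 μ) := by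
    refine tendsto_iff_forall_lipschitz_integral_tendsto.2 fun g ⟨C, hC⟩ ⟨L, hL⟩ => ?_
    have := h (BoundedContinuousFunction.mkOfBound ⟨g, hL.continuous⟩ C hC) ⟨L, hL⟩
    simp_rw [integral_empirical]
    exact (tendsto_add_atTop_iff_nat 1).2 this
  rw [← tendsto_add_atTop_iff_nat 1]
  have := ProbabilityMeasure.tendsto_iff_forall_integral_tendsto.1 hT f
  simpa only [integral_empirical] using this

/-- A π-system of neighbourhoods suffices for the weak convergence of empirical measures. -/
theorem tendsto_avg_of_isPiSystem [TopologicalSpace X] [SecondCountableTopology X]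
    [OpensMeasurableSpace X] [MeasurableSingletonClass X] {S : Set (Set X)} (hS : IsPiSystem S)
    (hmeas : ∀ s ∈ S, MeasurableSet s)
    (hnhds : ∀ u : Set X, IsOpen u → ∀ x ∈ u, ∃ s ∈ S, s ∈ 𝓝 x ∧ s ⊆ u)
    {v : (J : ℕ) → Fin J → X} {μ : ProbabilityMeasure X}
    (h : ∀ s ∈ S, Tendsto (fun J => avg fun j => s.indicator (1 : X → ℝ) (v J j)) atTop
      (𝓝 (∫ x, s.indicator (1 : X → ℝ) x ∂(μ : Measure X))))
    (f : BoundedContinuousFunction X ℝ) :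
    Tendsto (fun J => avg fun j => f (v J j)) atTop (𝓝 (∫ x, f x ∂(μ : Measure X))) := by
  have hT : Tendsto (fun J => empirical (v (J + 1))) atTop (𝓝 μ) := by
    refine hS.tendsto_probabilityMeasure_of_tendsto_of_mem hmeas hnhds fun s hs => ?_
    have := (tendsto_add_atTop_iff_nat 1).2 (h s hs)
    simp_rw [← integral_empirical, integral_indicator_one (hmeas s hs)] at this
    rw [← NNReal.tendsto_coe]
    exact this
  rw [← tendsto_add_atTop_iff_nat 1]
  have := ProbabilityMeasure.tendsto_iff_forall_integral_tendsto.1 hT f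
  simpa only [integral_empirical] using this

variable {Ω : Type*} [MeasurableSpace Ω] {P : Measure Ω} {U : ℕ → Ω → X} {γ : Measure X}

/-- The strong law of large numbers for functions of an i.i.d. sample. -/
theorem ae_tendsto_avg_comp {E : Type*} [NormedAddCommGroup E] [NormedSpace ℝ E] [CompleteSpace E]
    [MeasurableSpace E] [BorelSpace E] (hlaw : ∀ j, HasLaw (U j) γ P) (hindep : iIndepFun U P)
    {φ : X → E} (hφ : Measurable φ) (hinteg : Integrable φ γ) :
    ∀ᵐ ω ∂P, Tendsto (fun J => avg fun k : Fin J => φ (U k ω)) atTop (𝓝 (∫ x, φ x ∂γ)) := by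
  have hinteg' : Integrable (φ ∘ U 0) P := by
    rw [← (hlaw 0).map_eq] at hinteg
    exact hinteg.comp_aemeasurable (hlaw 0).aemeasurable
  have := strong_law_ae (μ := P) (fun j => φ ∘ U j) hinteg'
    (fun i j hij => (hindep.indepFun hij).comp hφ hφ)
    (fun i => ((hlaw i).identDistrib (hlaw 0)).comp hφ)
  rw [(hlaw 0).integral_comp hinteg.aestronglyMeasurable] at this
  filter_upwards [this] with ω hω
  refine hω.congr fun J => ?_
  rw [avg_eq_sum_range (fun k => φ (U k ω))]
  rfl

/-- Almost surely, the empirical measures of an i.i.d. sample converge weakly to its law. -/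
theorem ae_forall_tendsto_avg [TopologicalSpace X] [SecondCountableTopology X]
    [OpensMeasurableSpace X] [MeasurableSingletonClass X] [IsProbabilityMeasure γ]
    (hlaw : ∀ j, HasLaw (U j) γ P) (hindep : iIndepFun U P) :
    ∀ᵐ ω ∂P, ∀ f : BoundedContinuousFunction X ℝ,
      Tendsto (fun J => avg fun k : Fin J => f (U k ω)) atTop (𝓝 (∫ x, f x ∂γ)) := by
  -- Finite intersections of a countable basis form a countable π-system, so a single null set
  -- serves all test functions.
  set S : Set (Set X) := Set.sInter '' {t | t.Finite ∧ t ⊆ TopologicalSpace.countableBasis X}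
    with hSdef
  have hcount : S.Countable :=
    (Set.countable_ofPred_finite_subset (TopologicalSpace.countable_countableBasis X)).image _
  have hopen : ∀ s ∈ S, IsOpen s := by
    rintro _ ⟨t, ⟨hfin, ht⟩, rfl⟩
    exact hfin.isOpen_sInter fun s hs => TopologicalSpace.isOpen_of_mem_countableBasis (ht hs)
  have hpi : IsPiSystem S := by
    rintro _ ⟨t, ⟨hfin, ht⟩, rfl⟩ _ ⟨t', ⟨hfin', ht'⟩, rfl⟩ _
    exact ⟨t ∪ t', ⟨hfin.union hfin', Set.union_subset ht ht'⟩, Set.sInter_union t t'⟩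
  have hnhds : ∀ u : Set X, IsOpen u → ∀ x ∈ u, ∃ s ∈ S, s ∈ 𝓝 x ∧ s ⊆ u := by
    intro u hu x hx
    obtain ⟨s, hs, hxs, hsu⟩ :=
      (TopologicalSpace.isBasis_countableBasis X).exists_subset_of_mem_open hx hu
    exact ⟨s, ⟨{s}, ⟨Set.finite_singleton s, by simpa using hs⟩, by simp⟩,
      (TopologicalSpace.isOpen_of_mem_countableBasis hs).mem_nhds hxs, hsu⟩
  have hae : ∀ᵐ ω ∂P, ∀ s ∈ S,
      Tendsto (fun J => avg fun k : Fin J => s.indicator (1 : X → ℝ) (U k ω)) atTop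
        (𝓝 (∫ x, s.indicator (1 : X → ℝ) x ∂γ)) := by
    rw [ae_ball_iff hcount]
    intro s hs
    have hm := (hopen s hs).measurableSet
    exact ae_tendsto_avg_comp hlaw hindep (measurable_one.indicator hm)
      ((integrable_const (1 : ℝ)).indicator hm)
  filter_upwards [hae] with ω hω f
  exact tendsto_avg_of_isPiSystem (μ := ⟨γ, inferInstance⟩) hpi
    (fun s hs => (hopen s hs).measurableSet) hnhds hω f

end Empirical

/-! ### Gaussian integrals -/

section Gaussian

variable {d : ℕ}

theorem integrable_coord_stdGaussian (i : Fin d) :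
    Integrable (fun x : Space d => x i) (stdGaussian (Space d)) :=
  (EuclideanSpace.proj (𝕜 := ℝ) i).integrable_comp IsGaussian.integrable_id

theorem integral_coord_stdGaussian (i : Fin d) :
    ∫ x : Space d, x i ∂(stdGaussian (Space d)) = 0 :=
  integral_strongDual_stdGaussian (EuclideanSpace.proj (𝕜 := ℝ) i)

variable [NeZero d]

/-- Only the first coordinate of a Gaussian vector correlates with a function of it. -/
theorem integral_smul_stdGaussian {φ : ℝ → ℝ}
    (hφ : Integrable (fun x : Space d => φ (x 0) • x) (stdGaussian (Space d))) :
    ∫ x : Space d, φ (x 0) • x ∂(stdGaussian (Space d)) =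
      (∫ x : Space d, φ (x 0) * x 0 ∂(stdGaussian (Space d))) •
        EuclideanSpace.single (0 : Fin d) (1 : ℝ) := by
  set e : Space d := EuclideanSpace.single (0 : Fin d) (1 : ℝ) with he
  set γ := stdGaussian (Space d) with hγ
  have hinteg : Integrable (fun x : Space d => φ (x 0) * x 0) γ :=
    (EuclideanSpace.proj (𝕜 := ℝ) (0 : Fin d)).integrable_comp hφ
  -- This reflection preserves the Gaussian and the first coordinate and negates the others, so `x +
  -- R x` retains only the first component.
  set R : Space d ≃ₗᵢ[ℝ] Space d := (Submodule.span ℝ {e}).reflection with hR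
  have hRx : ∀ x, R x = (2 * x 0) • e - x := fun x => by
    rw [hR, Submodule.reflection_singleton_apply]
    simp [he, ← smul_assoc, EuclideanSpace.inner_single_left]
  have hR0 : ∀ x, R x 0 = x 0 := fun x => by
    rw [hRx]
    simp [he]
    ring
  have h1 : ∫ x, φ (x 0) • x ∂γ = ∫ x, φ (R x 0) • R x ∂γ := by
    conv_lhs => rw [hγ, ← stdGaussian_map R]
    exact R.toHomeomorph.measurableEmbedding.integral_map _
  have h2 : ∀ x : Space d, φ (R x 0) • R x = (2 * (φ (x 0) * x 0)) • e - φ (x 0) • x := fun x => by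
    rw [hR0, hRx, smul_sub, smul_smul]
    congr 2; ring
  simp_rw [h2] at h1
  rw [integral_sub ((hinteg.const_mul 2).smul_const e) hφ, integral_smul_const,
    integral_const_mul, eq_sub_iff_add_eq, ← two_smul ℝ, mul_smul] at h1
  exact smul_right_injective _ (two_ne_zero (α := ℝ)) h1

theorem continuous_aux_affineLSF (b : ℝ) : Continuous (aux (affineLSF d b)) := by
  unfold aux affineLSF
  fun_prop

theorem memLp_aux_affineLSF (b : ℝ) :
    MemLp (aux (affineLSF d b)) 2 (stdGaussian (Space d)) := by
  have h0 : MemLp (fun x : Space d => x 0) 2 (stdGaussian (Space d)) :=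
    (EuclideanSpace.proj (𝕜 := ℝ) (0 : Fin d)).comp_memLp' IsGaussian.memLp_two_id
  refine MemLp.mono (h0.sub (memLp_const b))
    (continuous_aux_affineLSF b).aestronglyMeasurable (.of_forall fun x => ?_)
  simp only [aux, affineLSF, Pi.sub_apply, Real.norm_eq_abs]
  rw [abs_of_nonneg (le_max_left _ _)]
  exact max_le (abs_nonneg _) (le_abs_self _)

theorem integrable_aux_affineLSF (b : ℝ) :
    Integrable (aux (affineLSF d b)) (stdGaussian (Space d)) :=
  (memLp_aux_affineLSF b).integrable one_le_two

theorem integrable_aux_smul (b : ℝ) :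
    Integrable (fun x : Space d => aux (affineLSF d b) x • x) (stdGaussian (Space d)) :=
  memLp_one_iff_integrable.1
    (IsGaussian.memLp_two_id.smul (memLp_aux_affineLSF b) (p := 2) (q := 2))

theorem integrable_aux_mul_self (b : ℝ) :
    Integrable (fun x : Space d => aux (affineLSF d b) x * aux (affineLSF d b) x)
      (stdGaussian (Space d)) :=
  (memLp_aux_affineLSF b).integrable_mul (memLp_aux_affineLSF b)

/-- The large-ensemble limit of the covariance of `G̃` with the first coordinate. -/
noncomputable def gaussianCov (d : ℕ) [NeZero d] (b : ℝ) : ℝ :=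
  ∫ x : Space d, aux (affineLSF d b) x * x 0 ∂(stdGaussian (Space d))

theorem integral_aux_smul (b : ℝ) :
    ∫ x : Space d, aux (affineLSF d b) x • x ∂(stdGaussian (Space d)) =
      gaussianCov d b • EuclideanSpace.single (0 : Fin d) (1 : ℝ) :=
  integral_smul_stdGaussian (φ := fun s => max 0 (s - b)) (integrable_aux_smul b)

/-- Adding the mean-zero term `b x₁` turns the integrand into `max(b, x₁) x₁`, which is positive
when `x₁ ≠ 0` because `b < 0`. A zero integral would make the first coordinate vanish almost surely,
against its nonzero variance. -/
theorem gaussianCov_pos {b : ℝ} (hb : b < 0) : 0 < gaussianCov d b := by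
  set γ := stdGaussian (Space d)
  have hinteg : Integrable (fun x : Space d => aux (affineLSF d b) x * x 0) γ :=
    (EuclideanSpace.proj (𝕜 := ℝ) (0 : Fin d)).integrable_comp (integrable_aux_smul b)
  have hx := (integrable_coord_stdGaussian (0 : Fin d)).const_mul b
  have he : gaussianCov d b = ∫ x : Space d, (aux (affineLSF d b) x * x 0 + b * x 0) ∂γ := by
    rw [integral_add hinteg hx, integral_const_mul, integral_coord_stdGaussian, gaussianCov]
    simp [γ]
  have hpos : ∀ x : Space d, x 0 ≠ 0 → 0 < aux (affineLSF d b) x * x 0 + b * x 0 := by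
    intro x hx
    simp only [aux, affineLSF]
    rcases le_total 0 (x 0 - b) with h | h
    · rw [max_eq_right h]
      have : 0 < x 0 ^ 2 := by positivity
      nlinarith
    · rw [max_eq_left h]
      nlinarith
  have hnn : ∀ x : Space d, 0 ≤ aux (affineLSF d b) x * x 0 + b * x 0 := by
    intro x
    rcases eq_or_ne (x 0) 0 with h | h
    · simp [h]
    · exact (hpos x h).le
  rw [he]
  refine (integral_nonneg hnn).lt_of_ne' fun h0 => ?_
  have hae := (integral_eq_zero_iff_of_nonneg hnn (hinteg.add hx)).1 h0
  set L : StrongDual ℝ (Space d) := EuclideanSpace.proj (𝕜 := ℝ) (0 : Fin d)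
  have hL0 : (L : Space d → ℝ) =ᵐ[γ] 0 := by
    filter_upwards [hae] with x hx
    by_contra hne
    exact (hpos x hne).ne' hx
  have hvar := variance_dual_stdGaussian L
  rw [variance_congr hL0, variance_zero] at hvar
  have hL : L = 0 := by
    rw [← norm_eq_zero]
    simpa using hvar.symm
  have := congrArg (fun T : StrongDual ℝ (Space d) => T (EuclideanSpace.single 0 1)) hL
  simp [L] at this

/-- Contracting the safe part of the Gaussian onto `G = 0` gives the mixture of the most likely
failure point and the mean of the optimal importance sampling density. -/
theorem neg_integral_aux (b : ℝ) :
    (-∫ x, aux (affineLSF d b) x ∂(stdGaussian (Space d))) •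
        EuclideanSpace.single (0 : Fin d) (1 : ℝ) =
      (1 - failureProb (affineLSF d b)) • EuclideanSpace.single (0 : Fin d) b +
        failureProb (affineLSF d b) • optMean (affineLSF d b) := by
  set γ := stdGaussian (Space d) with hγ
  set s : Set ℝ := Set.Iio b
  set S : Set (Space d) := {u | affineLSF d b u < 0} with hS
  have hmS : MeasurableSet S :=
    (isOpen_lt (by unfold affineLSF; fun_prop) continuous_const).measurableSet
  have hind : ∀ x : Space d, s.indicator (1 : ℝ → ℝ) (x 0) = S.indicator 1 x := fun x => by
    simp [s, S, affineLSF, Set.indicator]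
  have hxi : Integrable (fun x : Space d => s.indicator (1 : ℝ → ℝ) (x 0) • x) γ := by
    have : (fun x : Space d => s.indicator (1 : ℝ → ℝ) (x 0) • x) = S.indicator fun x => x := by
      ext1 x
      rw [hind]
      by_cases hx : x ∈ S <;> simp [hx]
    rw [this]
    exact Integrable.indicator IsGaussian.integrable_id hmS
  have hopt : failureProb (affineLSF d b) • optMean (affineLSF d b) =
      (∫ x : Space d, s.indicator (1 : ℝ → ℝ) (x 0) * x 0 ∂γ) •
        EuclideanSpace.single (0 : Fin d) (1 : ℝ) := by
    rw [← integral_smul_stdGaussian hxi]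
    have hset : ∫ x : Space d, s.indicator (1 : ℝ → ℝ) (x 0) • x ∂γ = ∫ x in S, x ∂γ := by
      rw [← integral_indicator hmS]
      congr 1 with x : 1
      rw [hind]
      by_cases hx : x ∈ S <;> simp [hx]
    rw [hset, optMean, failureProb, ProbabilityTheory.cond, ← hS, ← hγ, integral_smul_measure,
      smul_smul, ENNReal.toReal_inv, ← Measure.real]
    -- Treating the null case, where both sides vanish, avoids proving that `P_f` is positive.
    rcases eq_or_ne (γ.real S) 0 with h | h
    · have h' : γ S = 0 := (measureReal_eq_zero_iff (by finiteness)).1 h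
      rw [h, Measure.restrict_eq_zero.2 h']
      simp
    · rw [mul_inv_cancel₀ h, one_smul]
  have hscal : -∫ x, aux (affineLSF d b) x ∂γ = (1 - failureProb (affineLSF d b)) * b +
      ∫ x : Space d, s.indicator (1 : ℝ → ℝ) (x 0) * x 0 ∂γ := by
    -- This is `G̃ = G - 1_S G`.
    have hpt : ∀ x : Space d, aux (affineLSF d b) x =
        (x 0 - b) -
          (s.indicator (1 : ℝ → ℝ) (x 0) * x 0 - S.indicator (1 : Space d → ℝ) x * b) := by
      intro x
      rw [hind]
      simp only [aux, affineLSF]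
      by_cases hx : x ∈ S
      · have : x 0 - b < 0 := hx
        rw [max_eq_left this.le]
        simp [hx]
      · have : ¬ x 0 - b < 0 := hx
        rw [max_eq_right (not_lt.1 this)]
        simp [hx]
    have hxi0 : Integrable (fun x : Space d => s.indicator (1 : ℝ → ℝ) (x 0) * x 0) γ :=
      (EuclideanSpace.proj (𝕜 := ℝ) (0 : Fin d)).integrable_comp hxi
    have hSi : Integrable (S.indicator (1 : Space d → ℝ)) γ :=
      (integrable_const (1 : ℝ)).indicator hmS
    have hx0 := integrable_coord_stdGaussian (0 : Fin d)
    have hi : Integrable (fun x : Space d => x 0 - b) γ := hx0.sub (integrable_const b)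
    have hi' : Integrable (fun x : Space d => s.indicator (1 : ℝ → ℝ) (x 0) * x 0 -
        S.indicator (1 : Space d → ℝ) x * b) γ := hxi0.sub (hSi.mul_const b)
    simp_rw [hpt]
    rw [integral_sub hi hi',
      integral_sub hx0 (integrable_const b), integral_sub hxi0 (hSi.mul_const b),
      integral_mul_const, integral_indicator_one hmS, integral_coord_stdGaussian]
    simp only [integral_const, probReal_univ, failureProb, smul_eq_mul, ← hS, ← hγ]
    ring
  have hsingle : EuclideanSpace.single (0 : Fin d) b =
      b • EuclideanSpace.single (0 : Fin d) (1 : ℝ) := by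
    ext i
    simp [PiLp.single_apply]
  rw [hopt, hscal, add_smul, hsingle, smul_smul]

end Gaussian

end EnKF

/-! ### Most likely failure point and large-ensemble limit -/

namespace EnKF

variable {d : ℕ} [NeZero d]

/-- Pythagoras on the hyperplane (`hsub`) gives both minimality and uniqueness. -/
theorem isMLFP_affineLSF_iff (b : ℝ) (u : Space d) :
    IsMLFP (affineLSF d b) u ↔ u = EuclideanSpace.single (0 : Fin d) b := by
  have hG : ∀ v : Space d, affineLSF d b v = 0 ↔ v 0 = b := fun v => sub_eq_zero
  have hnorm : ‖(EuclideanSpace.single (0 : Fin d) b : Space d)‖ ^ 2 = b ^ 2 := by simp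
  have hsub : ∀ v : Space d, v 0 = b →
      ‖v - EuclideanSpace.single (0 : Fin d) b‖ ^ 2 = ‖v‖ ^ 2 - b ^ 2 := fun v hv => by
    rw [norm_sub_sq_real, hnorm, EuclideanSpace.inner_single_right, hv]
    simp
    ring
  constructor
  · rintro ⟨h0, hmin⟩
    have h1 := hmin (EuclideanSpace.single (0 : Fin d) b) ((hG _).2 (by simp))
    rw [hnorm] at h1
    have h2 := hsub u ((hG u).1 h0)
    have h3 : ‖u - EuclideanSpace.single (0 : Fin d) b‖ ^ 2 = 0 :=
      le_antisymm (by linarith) (by positivity)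
    exact sub_eq_zero.1 (norm_eq_zero.1 (pow_eq_zero_iff two_ne_zero |>.1 h3))
  · rintro rfl
    refine ⟨(hG _).2 (by simp), fun v hv => ?_⟩
    have h2 := hsub v ((hG v).1 hv)
    rw [hnorm]
    nlinarith [sq_nonneg ‖v - EuclideanSpace.single (0 : Fin d) b‖]

/-- The map moving the initial law to the large-ensemble limit with contraction factor `ρ`. -/
noncomputable def limitMap (b ρ : ℝ) (x : Space d) : Space d :=
  x - ((1 - ρ) * aux (affineLSF d b) x) • EuclideanSpace.single (0 : Fin d) (1 : ℝ)

theorem continuous_limitMap (b ρ : ℝ) : Continuous (limitMap (d := d) b ρ) := by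
  have := continuous_aux_affineLSF (d := d) b
  unfold limitMap
  fun_prop

/-- The large-ensemble limit with contraction factor `ρ`. -/
noncomputable def limitLaw (d : ℕ) [NeZero d] (b ρ : ℝ) : ProbabilityMeasure (Space d) :=
  ⟨(stdGaussian (Space d)).map (limitMap b ρ),
    Measure.isProbabilityMeasure_map (continuous_limitMap b ρ).aemeasurable⟩

theorem integrable_limitMap (b ρ : ℝ) :
    Integrable (limitMap (d := d) b ρ) (stdGaussian (Space d)) :=
  IsGaussian.integrable_id.sub (((integrable_aux_affineLSF b).const_mul (1 - ρ)).smul_const _)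

theorem integral_limitLaw {E : Type*} [NormedAddCommGroup E] [NormedSpace ℝ E] (b ρ : ℝ)
    {f : Space d → E} (hf : AEStronglyMeasurable f (limitLaw d b ρ : Measure (Space d))) :
    ∫ x, f x ∂(limitLaw d b ρ : Measure (Space d)) =
      ∫ x, f (limitMap b ρ x) ∂(stdGaussian (Space d)) :=
  integral_map (continuous_limitMap b ρ).aemeasurable hf

theorem integral_id_limitLaw (b ρ : ℝ) :
    ∫ x, x ∂(limitLaw d b ρ : Measure (Space d)) =
      -((1 - ρ) * ∫ x, aux (affineLSF d b) x ∂(stdGaussian (Space d))) •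
        EuclideanSpace.single (0 : Fin d) (1 : ℝ) := by
  rw [integral_limitLaw b ρ (f := fun x => x) aestronglyMeasurable_id]
  unfold limitMap
  rw [integral_sub (f := fun x : Space d => x) IsGaussian.integrable_id
    (((integrable_aux_affineLSF b).const_mul (1 - ρ)).smul_const _), integral_smul_const,
    integral_const_mul, integral_id_stdGaussian, zero_sub, neg_smul]

/-- The properties of a Gaussian sample that hold almost surely and determine the large-ensemble
limit. -/
structure IsTypical (b : ℝ) (x : ℕ → Space d) : Prop where
  weak : ∀ f : BoundedContinuousFunction (Space d) ℝ,
    Tendsto (fun J => avg fun k : Fin J => f (x k)) atTop (𝓝 (∫ y, f y ∂(stdGaussian (Space d))))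
  mean : Tendsto (fun J => avg fun k : Fin J => x k) atTop (𝓝 0)
  mean_obs : Tendsto (fun J => avg (obs b fun k : Fin J => x k)) atTop
    (𝓝 (∫ y, aux (affineLSF d b) y ∂(stdGaussian (Space d))))
  mean_obs_sq : Tendsto
    (fun J => avg fun j => obs b (fun k : Fin J => x k) j * obs b (fun k => x k) j) atTop
    (𝓝 (∫ y, aux (affineLSF d b) y * aux (affineLSF d b) y ∂(stdGaussian (Space d))))
  mean_obs_smul : Tendsto (fun J => avg fun j : Fin J => obs b (fun k : Fin J => x k) j • x j) atTop
    (𝓝 (gaussianCov d b • EuclideanSpace.single (0 : Fin d) (1 : ℝ)))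

theorem ae_isTypical (b : ℝ) {Ω : Type*} [MeasurableSpace Ω] {P : Measure Ω}
    {U : ℕ → Ω → Space d} (hlaw : ∀ j, HasLaw (U j) (stdGaussian (Space d)) P)
    (hindep : iIndepFun U P) : ∀ᵐ ω ∂P, IsTypical b fun j => U j ω := by
  have hm := (continuous_aux_affineLSF (d := d) b).measurable
  have h1 := ae_forall_tendsto_avg hlaw hindep
  have h2 := ae_tendsto_avg_comp hlaw hindep measurable_id IsGaussian.integrable_id
  have h3 := ae_tendsto_avg_comp hlaw hindep hm (integrable_aux_affineLSF b)
  have h4 := ae_tendsto_avg_comp hlaw hindep (hm.mul hm) (integrable_aux_mul_self b)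
  have h5 := ae_tendsto_avg_comp hlaw hindep (hm.smul measurable_id) (integrable_aux_smul b)
  filter_upwards [h1, h2, h3, h4, h5] with ω w1 w2 w3 w4 w5
  refine ⟨w1, ?_, w3, w4, ?_⟩
  · simpa [integral_id_stdGaussian] using w2
  · rw [← integral_aux_smul]
    exact w5

/-- The large-ensemble limit of the slope. -/
noncomputable def gaussianSlope (d : ℕ) [NeZero d] (b : ℝ) : ℝ :=
  ∫ y, aux (affineLSF d b) y * aux (affineLSF d b) y ∂(stdGaussian (Space d)) -
    (∫ y, aux (affineLSF d b) y ∂(stdGaussian (Space d))) *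
      ∫ y, aux (affineLSF d b) y ∂(stdGaussian (Space d))

namespace IsTypical

variable {b : ℝ} {x : ℕ → Space d}

theorem tendsto_slope (hx : IsTypical b x) :
    Tendsto (fun J => slope b fun k : Fin J => x k) atTop (𝓝 (gaussianSlope d b)) := by
  simp only [slope, ecov_eq, smul_eq_mul]
  exact hx.mean_obs_sq.sub (hx.mean_obs.mul hx.mean_obs)

theorem tendsto_ecov (hx : IsTypical b x) :
    Tendsto (fun J => ecov (obs b fun k : Fin J => x k) fun k => x k) atTop
      (𝓝 (gaussianCov d b • EuclideanSpace.single (0 : Fin d) (1 : ℝ))) := by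
  simp only [ecov_eq]
  simpa using hx.mean_obs_smul.sub (hx.mean_obs.smul hx.mean)

theorem tendsto_slope_add_intercept (hx : IsTypical b x) :
    Tendsto (fun J => (slope b fun k : Fin J => x k) + intercept b fun k : Fin J => x k) atTop
      (𝓝 (gaussianCov d b)) := by
  simp only [slope_add_intercept]
  have := ((EuclideanSpace.proj (𝕜 := ℝ) (0 : Fin d)).continuous.tendsto _).comp hx.tendsto_ecov
  simpa [Function.comp_def] using this

theorem tendsto_intercept (hx : IsTypical b x) :
    Tendsto (fun J => intercept b fun k : Fin J => x k) atTop
      (𝓝 (gaussianCov d b - gaussianSlope d b)) := by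
  simpa using hx.tendsto_slope_add_intercept.sub hx.tendsto_slope

/-- The sign is inherited from the empirical slopes of one typical sample. -/
theorem gaussianSlope_nonneg (hx : IsTypical b x) : 0 ≤ gaussianSlope d b :=
  ge_of_tendsto' hx.tendsto_slope fun _ => slope_nonneg _ _

theorem gaussianSlope_le (hx : IsTypical b x) : 0 ≤ gaussianCov d b - gaussianSlope d b :=
  ge_of_tendsto' hx.tendsto_intercept fun _ => intercept_nonneg _ _

/-- The covariance determines `e J` only where `A + B ≠ 0`; the positive limit ensures this for
large `J`. -/
theorem tendsto_direction (hx : IsTypical b x) (hb : b < 0) {e : ℕ → Space d}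
    (he : ∀ J, ecov (obs b fun k : Fin J => x k) (fun k => x k) =
      ((slope b fun k : Fin J => x k) + intercept b fun k : Fin J => x k) • e J) :
    Tendsto e atTop (𝓝 (EuclideanSpace.single (0 : Fin d) (1 : ℝ))) := by
  have hpos := gaussianCov_pos (d := d) hb
  have hlim := (hx.tendsto_slope_add_intercept.inv₀ hpos.ne').smul hx.tendsto_ecov
  rw [smul_smul, inv_mul_cancel₀ hpos.ne', one_smul] at hlim
  refine hlim.congr' ?_
  filter_upwards [hx.tendsto_slope_add_intercept.eventually (lt_mem_nhds hpos)] with J hJ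
  rw [he J, smul_smul, inv_mul_cancel₀ hJ.ne', one_smul]

/-- Each particle is coupled with the `limitMap` image of its own starting point. The gap is `G̃(x
j) • w J` with `w J → 0`, so a Lipschitz test function errs by at most `L ‖w J‖` times the mean of
`G̃`. -/
theorem isLargeEnsembleLimit (hx : IsTypical b x) {e : ℕ → Space d}
    (he : Tendsto e atTop (𝓝 (EuclideanSpace.single (0 : Fin d) (1 : ℝ)))) {ρ : ℕ → ℝ} {ρ' : ℝ}
    (hρ : Tendsto ρ atTop (𝓝 ρ')) :
    IsLargeEnsembleLimit (fun J => contracted b (fun k : Fin J => x k) (e J) (ρ J))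
      (limitLaw d b ρ') where
  weak := by
    refine tendsto_avg_of_lipschitz fun f ⟨L, hL⟩ => ?_
    set w : ℕ → Space d := fun J =>
      (1 - ρ') • EuclideanSpace.single (0 : Fin d) (1 : ℝ) - (1 - ρ J) • e J
    have hw : Tendsto w atTop (𝓝 0) := by
      have := ((hρ.const_sub 1).smul he).const_sub
        ((1 - ρ') • EuclideanSpace.single (0 : Fin d) (1 : ℝ))
      simpa using this
    have hdiff : ∀ J (j : Fin J), contracted b (fun k : Fin J => x k) (e J) (ρ J) j -
        limitMap b ρ' (x j) = obs b (fun k : Fin J => x k) j • w J := fun J j => by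
      simp only [contracted, limitMap, obs, w]
      module
    have hmain := hx.weak (f.compContinuous ⟨limitMap b ρ', continuous_limitMap b ρ'⟩)
    have herr : Tendsto (fun J => avg fun j =>
        (f (contracted b (fun k : Fin J => x k) (e J) (ρ J) j) - f (limitMap b ρ' (x j)))) atTop
        (𝓝 0) := by
      have hz : Tendsto (fun J => L * (avg (obs b fun k : Fin J => x k) * ‖w J‖)) atTop (𝓝 0) := by
        simpa using (hx.mean_obs.mul hw.norm).const_mul (L : ℝ)
      refine squeeze_zero_norm (fun J => ?_) hz
      refine (abs_avg_le _).trans ?_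
      rw [← avg_mul_const, ← avg_const_mul]
      refine avg_le_avg fun j => ?_
      have := hL.dist_le_mul (contracted b (fun k : Fin J => x k) (e J) (ρ J) j)
        (limitMap b ρ' (x j))
      rwa [dist_eq_norm, dist_eq_norm, hdiff, norm_smul, Real.norm_eq_abs, Real.norm_eq_abs,
        abs_of_nonneg (obs_nonneg _ _ _)] at this
    rw [integral_limitLaw b ρ' f.continuous.aestronglyMeasurable]
    simp only [avg_sub] at herr
    simpa using herr.add hmain
  integrable := (integrable_map_measure aestronglyMeasurable_id
    (continuous_limitMap b ρ').aemeasurable).2 (integrable_limitMap b ρ')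
  mean := by
    have hlim := hx.mean.sub (((hρ.const_sub 1).mul hx.mean_obs).smul he)
    rw [zero_sub, ← neg_smul] at hlim
    rw [integral_id_limitLaw]
    refine hlim.congr fun J => ?_
    change _ = avg fun j : Fin J => x j - ((1 - ρ J) * obs b (fun k : Fin J => x k) j) • e J
    rw [avg_sub, avg_smul_const, avg_const_mul]

end IsTypical

end EnKF

/-! ### Assembly of the limits -/

namespace EnKF

/-- The ensembles converge for small steps and large sizes, and so do the means for large times. -/
theorem exists_largeEnsembleLimit {d : ℕ} [NeZero d] (b : ℝ) (hb : b < 0)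
    {Ω : Type*} [MeasurableSpace Ω] (P : Measure Ω) [IsProbabilityMeasure P]
    (U₀ : ℕ → Ω → Space d)
    (hlaw : ∀ j, HasLaw (U₀ j) (stdGaussian (Space d)) P)
    (hindep : iIndepFun U₀ P) :
    ∃ (u : (J : ℕ) → Ω → ℝ → Fin J → Space d)
      (μ : ℝ → ProbabilityMeasure (Space d)),
      (∀ (J : ℕ) (ω : Ω),
        IsContinuousTimeLimit (affineLSF d b) (fun j => U₀ j ω) (u J ω)) ∧
      (∀ᵐ ω ∂P, ∀ t : ℝ, 0 ≤ t → IsLargeEnsembleLimit (fun J => u J ω t) (μ t)) ∧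
      Tendsto (fun t : ℝ => ∫ x, x ∂(μ t : Measure (Space d))) atTop
        (𝓝 ((1 - failureProb (affineLSF d b)) • EuclideanSpace.single (0 : Fin d) b +
          failureProb (affineLSF d b) • optMean (affineLSF d b))) := by
  choose e he hD using fun (J : ℕ) (ω : Ω) => exists_direction b fun j : Fin J => U₀ j ω
  choose r hr using fun (J : ℕ) (ω : Ω) =>
    exists_isDecay (slope_nonneg b fun j : Fin J => U₀ j ω)
      (intercept_nonneg b fun j : Fin J => U₀ j ω)
  have htyp := ae_isTypical b hlaw hindep
  -- One typical outcome supplies the signs of the deterministic limiting coefficients.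
  obtain ⟨ω₀, hω₀⟩ := htyp.exists
  have hA := hω₀.gaussianSlope_nonneg
  have hB := hω₀.gaussianSlope_le
  obtain ⟨r', hr'⟩ := exists_isDecay hA hB
  refine ⟨fun J ω t => contracted b (fun j => U₀ j ω) (e J ω) (r J ω t),
    fun t => limitLaw d b (r' t),
    fun J ω => isContinuousTimeLimit_contracted (he J ω) (hD J ω) (hr J ω), ?_, ?_⟩
  · filter_upwards [htyp] with ω hω t ht
    exact hω.isLargeEnsembleLimit (hω.tendsto_direction hb fun J => hD J ω)
      (hr'.tendsto_of_tendsto hA hB (fun J => hr J ω) hω.tendsto_slope hω.tendsto_intercept ht)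
  · have h0 := hr'.tendsto_atTop hA hB (by linarith [gaussianCov_pos (d := d) hb])
    simp_rw [integral_id_limitLaw]
    rw [← neg_integral_aux]
    refine Tendsto.smul_const ?_ _
    simpa using ((h0.const_sub 1).mul_const
      (∫ x, aux (affineLSF d b) x ∂(stdGaussian (Space d)))).neg

end EnKF

theorem theorem3 {d : ℕ} [NeZero d] (b : ℝ) (hb : b < 0)
    {Ω : Type*} [MeasurableSpace Ω] (P : Measure Ω) [IsProbabilityMeasure P]
    (U₀ : ℕ → Ω → EnKF.Space d)
    (hlaw : ∀ j, HasLaw (U₀ j) (stdGaussian (EnKF.Space d)) P)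
    (hindep : iIndepFun U₀ P) :
    (∀ u : EnKF.Space d,
      EnKF.IsMLFP (EnKF.affineLSF d b) u ↔ u = EuclideanSpace.single (0 : Fin d) b) ∧
    ∃ (u : (J : ℕ) → Ω → ℝ → Fin J → EnKF.Space d)
      (μ : ℝ → ProbabilityMeasure (EnKF.Space d)),
      (∀ (J : ℕ) (ω : Ω),
        EnKF.IsContinuousTimeLimit (EnKF.affineLSF d b) (fun j => U₀ j ω) (u J ω)) ∧
      (∀ᵐ ω ∂P, ∀ t : ℝ, 0 ≤ t → EnKF.IsLargeEnsembleLimit (fun J => u J ω t) (μ t)) ∧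
      Tendsto (fun t : ℝ => ∫ x, x ∂(μ t : Measure (EnKF.Space d))) atTop
        (𝓝 ((1 - EnKF.failureProb (EnKF.affineLSF d b)) • EuclideanSpace.single (0 : Fin d) b +
          EnKF.failureProb (EnKF.affineLSF d b) • EnKF.optMean (EnKF.affineLSF d b))) := by
  exact ⟨EnKF.isMLFP_affineLSF_iff b, EnKF.exists_largeEnsembleLimit b hb P U₀ hlaw hindep⟩
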